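/- Let $0<\beta\le 1$ and $c>0$, and let $\xi$ be a positive random variable such that $-\log P[\xi>t]\sim c\,t^{\beta}$ as $t\to\infty$. Let $\xi_1,\xi_2$ be independent copies of $\xi$, and let $Y=(Y_s)_{s\ge 0}$ be a standard one-dimensional Brownian motion started at $0$ such that the pair $(\xi_1,\xi_2)$ is independent of $Y$. Let $$\eta=\inf\{s\ge 0:\ Y_s\notin(-\xi_1,\xi_2)\}$$ be the first exit time of $Y$ from the random interval $(-\xi_1,\xi_2)$ (with $\inf\emptyset=\infty$). Then, as $t\to\infty$, $$-\log P[\eta>t]\ \sim\ \frac{2+\beta}{2}\;c^{2/(2+\beta)}\,\beta^{-\beta/(2+\beta)}\,\pi^{2\beta/(2+\beta)}\;t^{\beta/(2+\beta)}.$$ Here $f(t)\sim g(t)$ as $t\to\infty$ means that $f(t)/g(t)\to 1$. -/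

import Mathlib

open MeasureTheory ProbabilityTheory Filter
open scoped NNReal ENNReal

/-- The first exit time `inf {s ≥ 0 : y s ∉ D}` of the path `y` from the set `D`, with values in
`[0, ∞]`; it is `∞` if the path never leaves `D`. -/
noncomputable def firstExitTime (y : ℝ≥0 → ℝ) (D : Set ℝ) : ℝ≥0∞ :=
  ⨅ (s : ℝ≥0) (_ : y s ∉ D), (s : ℝ≥0∞)

open scoped Topology

/-! To survive past time `t`, it is cheapest for the interval to be of order `L = t ^ (1 / (2 +
β))`. If it is `(-a L, b L)`, the two tails cost `c (a ^ β + b ^ β)` and the Brownian path costs `π²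
/ (2 (a + b)²)`, both in units of `t ^ (β / (2 + β))`. As `β ≤ 1`, `a ^ β + b ^ β ≥ (a + b) ^ β`, so
it is best to make one side small and the other long. What remains is the minimum of `c x ^ β + π² /
(2 x²)`, computed by weighted AM-GM (`exitRate_le`).

The confinement estimates `measureReal_pathStays_upper` and `measureReal_pathStays_lower` come from
the cosine eigenfunction on a time grid. One Gaussian step of length `h` multiplies the mean of `cos
(l (B - m))` by `exp (-h l² / 2)`. The part of the mean lost on leaving the interval has a known
sign unless a single increment is large, and the total probability of large increments vanishes as
the grid is refined.

For the upper bound (`decaysAtLeast_exitTime`), both endpoints are sorted into finitely many bins of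
width `δ L`. For the lower bound (`decaysAtMost_exitTime`), one almost optimal configuration is
enough. -/

theorem gaussianReal_abs_ge_le (v : ℝ≥0) {r : ℝ} (hr : 0 ≤ r) :
    (gaussianReal 0 v).real {x | r ≤ |x|} ≤ 2 * Real.exp (-r ^ 2 / (2 * v)) := by
  rcases eq_or_ne v 0 with rfl | hv
  · have : (gaussianReal 0 0).real {x : ℝ | r ≤ |x|} ≤ 1 := measureReal_le_one
    simp only [NNReal.coe_zero, mul_zero, div_zero, Real.exp_zero, mul_one]
    linarith
  have hv' : (0 : ℝ) < v := by positivity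
  have hint : ∀ s : ℝ, Integrable (fun x ↦ Real.exp (s * id x)) (gaussianReal 0 v) :=
    fun s ↦ integrable_exp_mul_gaussianReal s
  -- The parameter `r / v` optimizes the Chernoff bound.
  have h1 := measure_ge_le_exp_mul_mgf (μ := gaussianReal 0 v) (X := id) (t := r / v) r
    (by positivity) (hint _)
  have h2 := measure_le_le_exp_mul_mgf (μ := gaussianReal 0 v) (X := id) (t := -(r / v)) (-r)
    (by rw [neg_nonpos]; positivity) (hint _)
  have e : ∀ s : ℝ, s ^ 2 = (r / v) ^ 2 → Real.exp (-(r / v) * r) * mgf id (gaussianReal 0 v) s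
      = Real.exp (-r ^ 2 / (2 * v)) := by
    intro s hs
    rw [mgf_id_gaussianReal]
    simp only [zero_mul, zero_add]
    rw [← Real.exp_add, hs]
    congr 1
    field_simp
    ring
  rw [e _ rfl] at h1
  rw [show -(-(r / (v : ℝ))) * -r = -(r / v) * r by ring, e _ (by ring)] at h2
  have hsub : {x : ℝ | r ≤ |x|} ⊆ {x | r ≤ id x} ∪ {x | id x ≤ -r} := by
    intro x hx
    rcases le_abs.1 (show r ≤ |x| from hx) with h | h
    · exact Or.inl h
    · exact Or.inr (by simp only [id, Set.mem_ofPred_eq]; linarith)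
  calc _ ≤ _ := measureReal_mono hsub
    _ ≤ _ := measureReal_union_le _ _
    _ ≤ _ := by linarith

/-! ### Brownian motion on a time grid: the one-step cosine identity -/

section Skeleton

variable {Ω : Type*}

/-- The event that the process `B` is in `D` at the times `0, h, …, k h`. -/
def skeletonStays (B : ℝ≥0 → Ω → ℝ) (h : ℝ≥0) (D : Set ℝ) (k : ℕ) : Set Ω :=
  {ω | ∀ j ≤ k, B (j * h) ω ∈ D}

theorem skeletonStays_succ (B : ℝ≥0 → Ω → ℝ) (h : ℝ≥0) (D : Set ℝ) (k : ℕ) :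
    skeletonStays B h D (k + 1) =
      skeletonStays B h D k ∩ {ω | B ((k + 1 : ℕ) * h) ω ∈ D} := by
  ext ω
  simp only [skeletonStays, Set.mem_ofPred_eq, Set.mem_inter_iff, Nat.le_succ_iff]
  constructor
  · exact fun H ↦ ⟨fun j hj ↦ H j (Or.inl hj), H _ (Or.inr rfl)⟩
  · rintro ⟨H1, H2⟩ j (hj | rfl)
    exacts [H1 j hj, H2]

variable [MeasurableSpace Ω] {P : Measure Ω} {B : ℝ≥0 → Ω → ℝ}

theorem measurableSet_skeletonStays (hm : ∀ t, Measurable (B t)) (h : ℝ≥0) {D : Set ℝ}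
    (hD : MeasurableSet D) (k : ℕ) : MeasurableSet (skeletonStays B h D k) := by
  have : skeletonStays B h D k = ⋂ j : ℕ, ⋂ _ : j ≤ k, B (j * h) ⁻¹' D := by
    ext; simp [skeletonStays]
  rw [this]
  exact .iInter fun j ↦ .iInter fun _ ↦ hm _ hD

/-- The next increment is independent of the past up to `k h`. The complex exponential, unlike the
cosine, splits into a factor in the increment, whose mean is a Gaussian characteristic function, and
a factor in the past. -/
theorem setIntegral_cexp_skeletonStays_succ (hB : IsPreBrownianReal B P)
    (hm : ∀ t, Measurable (B t)) (h : ℝ≥0) {D : Set ℝ} (hD : MeasurableSet D) (l m : ℝ) (k : ℕ) :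
    ∫ ω in skeletonStays B h D k,
        Complex.exp (((l * (B ((k + 1 : ℕ) * h) ω - m) : ℝ) : ℂ) * Complex.I) ∂P =
      Complex.exp (-(h * l ^ 2 / 2)) * ∫ ω in skeletonStays B h D k,
        Complex.exp (((l * (B (k * h) ω - m) : ℝ) : ℂ) * Complex.I) ∂P := by
  have hle : ∀ j, j ≤ k → (j : ℝ≥0) * h ≤ k * h := fun j hj ↦ by gcongr
  set S : Set (Set.Iic ((k : ℝ≥0) * h) → ℝ) :=
    {y | ∀ j (hj : j ≤ k), y ⟨j * h, hle j hj⟩ ∈ D} with hS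
  have hSm : MeasurableSet S := by
    have : S = ⋂ j : ℕ, ⋂ hj : j ≤ k, (fun y ↦ y ⟨j * h, hle j hj⟩) ⁻¹' D := by
      ext; simp [hS]
    rw [this]
    exact .iInter fun j ↦ .iInter fun _ ↦ measurable_pi_apply _ hD
  set f : (ℝ≥0 → ℝ) → ℂ := fun y ↦ Complex.exp (((l * y h : ℝ) : ℂ) * Complex.I) with hf
  set g : (Set.Iic ((k : ℝ≥0) * h) → ℝ) → ℂ := S.indicator fun y ↦
    Complex.exp (((l * (y ⟨k * h, Set.mem_Iic.2 le_rfl⟩ - m) : ℝ) : ℂ) * Complex.I) with hg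
  have hfm : Measurable f := by fun_prop
  have hgm : Measurable g := Measurable.indicator (by fun_prop) hSm
  have key := (hB.indepFun_shift (k * h)).integral_fun_comp_mul_comp (f := f) (g := g)
    (measurable_pi_lambda _ fun t ↦ (hm _).sub (hm _)).aemeasurable
    (measurable_pi_lambda _ fun t ↦ hm _).aemeasurable
    hfm.aestronglyMeasurable hgm.aestronglyMeasurable
  have hAm := measurableSet_skeletonStays hm h hD k
  have hmem : ∀ ω, (fun t : Set.Iic ((k : ℝ≥0) * h) ↦ B t ω) ∈ S ↔ ω ∈ skeletonStays B h D k :=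
    fun ω ↦ Iff.rfl
  have e0 : ((k + 1 : ℕ) : ℝ≥0) * h = k * h + h := by push_cast; ring
  have e1 : ∫ ω, f (fun t ↦ B (k * h + t) ω - B (k * h) ω) ∂P =
      Complex.exp (-(h * l ^ 2 / 2)) := by
    have hl : HasLaw (fun ω ↦ B (k * h + h) ω - B (k * h) ω) (gaussianReal 0 h) P :=
      (hB.shift (k * h)).hasLaw_eval h
    have hi := hl.integral_comp (f := fun x : ℝ ↦ Complex.exp (((l * x : ℝ) : ℂ) * Complex.I))
      (by fun_prop)
    refine hi.trans ?_
    have hc := charFun_gaussianReal (μ := 0) (v := h) l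
    rw [charFun_apply_real] at hc
    push_cast at hc ⊢
    rw [hc]
    congr 1
    simp
  have e2 : ∫ ω, g (fun t ↦ B t ω) ∂P = ∫ ω in skeletonStays B h D k,
        Complex.exp (((l * (B (k * h) ω - m) : ℝ) : ℂ) * Complex.I) ∂P := by
    rw [← integral_indicator hAm]
    congr 1
  have e3 : ∫ ω, f (fun t ↦ B (k * h + t) ω - B (k * h) ω) * g (fun t ↦ B t ω) ∂P =
      ∫ ω in skeletonStays B h D k,
        Complex.exp (((l * (B ((k + 1 : ℕ) * h) ω - m) : ℝ) : ℂ) * Complex.I) ∂P := by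
    rw [← integral_indicator hAm]
    congr 1
    ext ω
    by_cases hω : ω ∈ skeletonStays B h D k
    · rw [Set.indicator_of_mem hω, hg, Set.indicator_of_mem ((hmem ω).2 hω), hf, e0]
      simp only
      rw [← Complex.exp_add]
      congr 1
      push_cast
      ring
    · rw [Set.indicator_of_notMem hω, hg, Set.indicator_of_notMem (mt (hmem ω).1 hω), mul_zero]
  rw [← e3, key, e1, e2]

theorem setIntegral_cos_skeletonStays_succ (hB : IsPreBrownianReal B P)
    (hm : ∀ t, Measurable (B t)) (h : ℝ≥0) {D : Set ℝ} (hD : MeasurableSet D) (l m : ℝ) (k : ℕ) :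
    ∫ ω in skeletonStays B h D k, Real.cos (l * (B ((k + 1 : ℕ) * h) ω - m)) ∂P =
      Real.exp (-(h * l ^ 2 / 2)) *
        ∫ ω in skeletonStays B h D k, Real.cos (l * (B (k * h) ω - m)) ∂P := by
  have := hB.isGaussianProcess.isProbabilityMeasure
  have hint : ∀ t, Integrable (fun ω ↦ Complex.exp (((l * (B t ω - m) : ℝ) : ℂ) * Complex.I))
      (P.restrict (skeletonStays B h D k)) := fun t ↦ by
    refine .of_bound (C := 1) ?_ (.of_forall fun ω ↦ (Complex.norm_exp_ofReal_mul_I _).le)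
    have := hm t
    exact (by fun_prop : Measurable _).aestronglyMeasurable
  have hre : ∀ t, ∫ ω in skeletonStays B h D k, Real.cos (l * (B t ω - m)) ∂P =
      (∫ ω in skeletonStays B h D k,
        Complex.exp (((l * (B t ω - m) : ℝ) : ℂ) * Complex.I) ∂P).re := fun t ↦ by
    have := integral_re (hint t)
    simp only [RCLike.re_eq_complex_re] at this
    rw [← this]
    simp only [Complex.exp_ofReal_mul_I_re]
  rw [hre, hre, setIntegral_cexp_skeletonStays_succ hB hm h hD]
  rw [show Complex.exp (-(h * l ^ 2 / 2)) = ((Real.exp (-(h * l ^ 2 / 2)) : ℝ) : ℂ) by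
    push_cast; rfl, Complex.re_ofReal_mul]

theorem measureReal_increment_le (hB : IsPreBrownianReal B P) (h : ℝ≥0) {r : ℝ} (hr : 0 ≤ r)
    (k : ℕ) : P.real {ω | r ≤ |B ((k + 1 : ℕ) * h) ω - B (k * h) ω|} ≤
      2 * Real.exp (-r ^ 2 / (2 * h)) := by
  have e0 : ((k + 1 : ℕ) : ℝ≥0) * h = k * h + h := by push_cast; ring
  have hl : HasLaw (fun ω ↦ B (k * h + h) ω - B (k * h) ω) (gaussianReal 0 h) P :=
    (hB.shift (k * h)).hasLaw_eval h
  have hms : MeasurableSet {x : ℝ | r ≤ |x|} := measurableSet_le (by fun_prop) (by fun_prop)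
  refine le_trans (le_of_eq ?_) (gaussianReal_abs_ge_le h hr)
  rw [← hl.map_eq, map_measureReal_apply_of_aemeasurable hl.aemeasurable hms, e0]
  rfl
end Skeleton

/-! ### Confinement bounds on the grid -/

section SkeletonBounds

variable {Ω : Type*} [MeasurableSpace Ω] {P : Measure Ω} {B : ℝ≥0 → Ω → ℝ}

theorem setIntegral_le_measureReal_of_le_indicator [IsFiniteMeasure P] {S R : Set Ω} {f : Ω → ℝ}
    (hS : MeasurableSet S) (hR : MeasurableSet R) (hf : Integrable f P)
    (hle : ∀ ω ∈ S, f ω ≤ R.indicator 1 ω) : ∫ ω in S, f ω ∂P ≤ P.real R := by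
  have hi : Integrable (R.indicator (1 : Ω → ℝ)) P := (integrable_const 1).indicator hR
  calc ∫ ω in S, f ω ∂P ≤ ∫ ω in S, R.indicator 1 ω ∂P :=
        setIntegral_mono_on hf.integrableOn hi.integrableOn hS hle
    _ ≤ ∫ ω, R.indicator 1 ω ∂P :=
        setIntegral_le_integral hi (.of_forall fun ω ↦ Set.indicator_nonneg (by simp) ω)
    _ = P.real R := integral_indicator_one hR

/-- Since `q ≤ 1`, earlier errors are never amplified, and `n` steps add at most `n p`. -/
theorem le_pow_mul_add_of_succ_le {M : ℕ → ℝ} {q p : ℝ} (hq : 0 ≤ q) (hq1 : q ≤ 1) (hp : 0 ≤ p)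
    (hM : ∀ k, M (k + 1) ≤ q * M k + p) (n : ℕ) : M n ≤ q ^ n * M 0 + n * p := by
  induction n with
  | zero => simp
  | succ n ih =>
    have h1 : q * M n ≤ q * (q ^ n * M 0 + n * p) := by gcongr
    have h2 : q * (n * p) ≤ 1 * (n * p) := by gcongr
    calc M (n + 1) ≤ q * M n + p := hM n
      _ ≤ q * (q ^ n * M 0 + n * p) + p := by gcongr
      _ ≤ q ^ (n + 1) * M 0 + (n + 1 : ℕ) * p := by
        push_cast
        rw [pow_succ]
        linarith

theorem integrable_cos_comp [IsFiniteMeasure P] (hm : ∀ t, Measurable (B t)) (l m : ℝ) (t : ℝ≥0) :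
    Integrable (fun ω ↦ Real.cos (l * (B t ω - m))) P := by
  refine .of_bound (C := 1) ?_ (.of_forall fun ω ↦ Real.abs_cos_le_one _)
  have := hm t
  exact (by fun_prop : Measurable _).aestronglyMeasurable

theorem setIntegral_cos_inter_add_diff (hB : IsPreBrownianReal B P) (hm : ∀ t, Measurable (B t))
    (h : ℝ≥0) {D : Set ℝ} (hD : MeasurableSet D) (l m : ℝ) (k : ℕ) :
    (∫ ω in skeletonStays B h D (k + 1), Real.cos (l * (B ((k + 1 : ℕ) * h) ω - m)) ∂P) +
      (∫ ω in skeletonStays B h D k \ {ω | B ((k + 1 : ℕ) * h) ω ∈ D},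
        Real.cos (l * (B ((k + 1 : ℕ) * h) ω - m)) ∂P) =
      Real.exp (-(h * l ^ 2 / 2)) *
        ∫ ω in skeletonStays B h D k, Real.cos (l * (B (k * h) ω - m)) ∂P := by
  have := hB.isGaussianProcess.isProbabilityMeasure
  rw [← setIntegral_cos_skeletonStays_succ hB hm h hD, skeletonStays_succ]
  exact integral_inter_add_sdiff (hm _ hD) (integrable_cos_comp hm l m _).integrableOn

theorem exp_neg_mul_sq_pow (h : ℝ≥0) (l : ℝ) (n : ℕ) :
    Real.exp (-(h * l ^ 2 / 2)) ^ n = Real.exp (-(n * h * l ^ 2 / 2)) := by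
  rw [← Real.exp_nat_mul]
  congr 1
  ring

/-- A frequency slightly below `π / (v - u)` keeps the cosine at least `cos (θ π / 2) > 0` on the
interval and nonnegative on a margin `r` around it. Discarding the paths that leave can then
increase the mean only through jumps of size at least `r`. -/
theorem skeletonStays_upper_bound (hB : IsPreBrownianReal B P) (hm : ∀ t, Measurable (B t))
    (h : ℝ≥0) {u v θ : ℝ} (huv : u < v) (hθ : 0 < θ) (hθ1 : θ < 1) (n : ℕ) :
    P.real (skeletonStays B h (Set.Icc u v) n) * Real.cos (θ * (Real.pi / 2)) ≤
      Real.exp (-(n * h * (θ * Real.pi / (v - u)) ^ 2 / 2)) +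
        n * (2 * Real.exp (-((v - u) / (2 * θ) - (v - u) / 2) ^ 2 / (2 * h))) := by
  have := hB.isGaussianProcess.isProbabilityMeasure
  have hpi := Real.pi_pos
  obtain ⟨d, hd⟩ : ∃ d, d = v - u := ⟨_, rfl⟩
  have hd0 : 0 < d := by linarith
  rw [← hd]
  set l := θ * Real.pi / d with hl
  have hl0 : 0 < l := by positivity
  set m := (u + v) / 2 with hmdef
  set r := d / (2 * θ) - d / 2 with hrdef
  have hr : 0 ≤ r := by
    have : d / 2 ≤ d / (2 * θ) := div_le_div_of_nonneg_left hd0.le (by positivity) (by linarith)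
    linarith
  have hlr : l * (d / 2 + r) = Real.pi / 2 := by
    rw [hrdef, hl]; field_simp; ring
  have hld : l * (d / 2) = θ * (Real.pi / 2) := by
    rw [hl]; field_simp
  have hin : ∀ x ∈ Set.Icc u v, |x - m| ≤ d / 2 := by
    rintro x ⟨h1, h2⟩
    rw [abs_le]
    constructor <;> linarith
  set M : ℕ → ℝ := fun k ↦
    ∫ ω in skeletonStays B h (Set.Icc u v) k, Real.cos (l * (B (k * h) ω - m)) ∂P with hM
  set p := 2 * Real.exp (-r ^ 2 / (2 * h)) with hp
  have hstep : ∀ k, M (k + 1) ≤ Real.exp (-(h * l ^ 2 / 2)) * M k + p := by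
    intro k
    have h1 := setIntegral_cos_inter_add_diff hB hm h (D := Set.Icc u v) measurableSet_Icc l m k
    have h2 : ∫ ω in skeletonStays B h (Set.Icc u v) k \ {ω | B ((k + 1 : ℕ) * h) ω ∈ Set.Icc u v},
        -Real.cos (l * (B ((k + 1 : ℕ) * h) ω - m)) ∂P ≤ p := by
      refine (setIntegral_le_measureReal_of_le_indicator
        ((measurableSet_skeletonStays hm h measurableSet_Icc k).diff (hm _ measurableSet_Icc))
        (R := {ω | r ≤ |B ((k + 1 : ℕ) * h) ω - B (k * h) ω|})
        (measurableSet_le (by fun_prop) (((hm _).sub (hm _)).abs))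
        (integrable_cos_comp hm l m _).neg ?_).trans (measureReal_increment_le hB h hr k)
      rintro ω ⟨hω, -⟩
      by_cases hω2 : ω ∈ {ω | r ≤ |B ((k + 1 : ℕ) * h) ω - B (k * h) ω|}
      · rw [Set.indicator_of_mem hω2]
        exact neg_le.1 (Real.neg_one_le_cos _)
      · rw [Set.indicator_of_notMem hω2, Pi.neg_apply, neg_nonpos]
        have h3 : |B ((k + 1 : ℕ) * h) ω - m| ≤ d / 2 + r := by
          have := abs_sub_le (B ((k + 1 : ℕ) * h) ω) (B (k * h) ω) m
          have := hin _ (hω k le_rfl)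
          have := not_le.1 fun h' : r ≤ |B ((k + 1 : ℕ) * h) ω - B (k * h) ω| ↦ hω2 h'
          linarith
        have h4 : |l * (B ((k + 1 : ℕ) * h) ω - m)| ≤ Real.pi / 2 := by
          rw [abs_mul, abs_of_pos hl0, ← hlr]
          gcongr
        exact Real.cos_nonneg_of_mem_Icc (abs_le.1 h4)
    rw [integral_neg] at h2
    simp only [hM]
    linarith
  have hMn := le_pow_mul_add_of_succ_le (Real.exp_nonneg _)
    (Real.exp_le_one_iff.2 (by rw [neg_nonpos]; positivity)) (by positivity) hstep n
  rw [exp_neg_mul_sq_pow] at hMn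
  have hM0 : M 0 ≤ 1 := by
    refine (setIntegral_le_measureReal_of_le_indicator
      (measurableSet_skeletonStays hm h measurableSet_Icc 0) .univ
      (integrable_cos_comp hm l m _) fun ω _ ↦ ?_).trans measureReal_le_one
    simpa using Real.cos_le_one _
  have hMlow : P.real (skeletonStays B h (Set.Icc u v) n) * Real.cos (θ * (Real.pi / 2)) ≤ M n := by
    have : ∫ ω in skeletonStays B h (Set.Icc u v) n, Real.cos (θ * (Real.pi / 2)) ∂P ≤ M n := by
      refine setIntegral_mono_on (integrable_const _).integrableOn
        (integrable_cos_comp hm l m _).integrableOn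
        (measurableSet_skeletonStays hm h measurableSet_Icc n) fun ω hω ↦ ?_
      rw [← Real.cos_abs (l * _)]
      refine Real.cos_le_cos_of_nonneg_of_le_pi (abs_nonneg _) ?_ ?_
      · nlinarith
      · rw [abs_mul, abs_of_pos hl0, ← hld]
        gcongr
        exact hin _ (hω n le_rfl)
    simpa using this
  have : Real.exp (-(n * h * l ^ 2 / 2)) * M 0 ≤ Real.exp (-(n * h * l ^ 2 / 2)) * 1 := by gcongr
  linarith

/-- At frequency exactly `π / (v - u)` the cosine is nonpositive at distance up to `v - u` outside
the interval. Discarding the paths that leave can then decrease the mean only through jumps of at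
least the interval's length. -/
theorem skeletonStays_lower_bound (hB : IsPreBrownianReal B P) (hm : ∀ t, Measurable (B t))
    (h : ℝ≥0) {u v : ℝ} (hu : u < 0) (hv : 0 < v) (n : ℕ) :
    Real.exp (-(n * h * (Real.pi / (v - u)) ^ 2 / 2)) *
        Real.cos (Real.pi / (v - u) * ((u + v) / 2)) -
      n * (2 * Real.exp (-(v - u) ^ 2 / (2 * h))) ≤
      P.real (skeletonStays B h (Set.Icc u v) n) := by
  have := hB.isGaussianProcess.isProbabilityMeasure
  have hpi := Real.pi_pos
  obtain ⟨d, hd⟩ : ∃ d, d = v - u := ⟨_, rfl⟩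
  have hd0 : 0 < d := by linarith
  rw [← hd]
  set l := Real.pi / d with hl
  have hl0 : 0 < l := by positivity
  set m := (u + v) / 2 with hmdef
  have hld : l * (d / 2) = Real.pi / 2 := by
    rw [hl]; field_simp
  have hin : ∀ x ∈ Set.Icc u v, |x - m| ≤ d / 2 := by
    rintro x ⟨h1, h2⟩
    rw [abs_le]
    constructor <;> linarith
  have hout : ∀ x ∉ Set.Icc u v, d / 2 ≤ |x - m| := by
    intro x hx
    by_contra! hlt
    rw [abs_lt] at hlt
    exact hx ⟨by linarith, by linarith⟩
  -- The sign is reversed so that the lower bound on the mean obeys the same recursive inequality as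
  -- in the upper bound.
  set M : ℕ → ℝ := fun k ↦
    -∫ ω in skeletonStays B h (Set.Icc u v) k, Real.cos (l * (B (k * h) ω - m)) ∂P with hM
  set p := 2 * Real.exp (-d ^ 2 / (2 * h)) with hp
  have hstep : ∀ k, M (k + 1) ≤ Real.exp (-(h * l ^ 2 / 2)) * M k + p := by
    intro k
    have h1 := setIntegral_cos_inter_add_diff hB hm h (D := Set.Icc u v) measurableSet_Icc l m k
    have h2 : ∫ ω in skeletonStays B h (Set.Icc u v) k \ {ω | B ((k + 1 : ℕ) * h) ω ∈ Set.Icc u v},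
        Real.cos (l * (B ((k + 1 : ℕ) * h) ω - m)) ∂P ≤ p := by
      refine (setIntegral_le_measureReal_of_le_indicator
        ((measurableSet_skeletonStays hm h measurableSet_Icc k).diff (hm _ measurableSet_Icc))
        (R := {ω | d ≤ |B ((k + 1 : ℕ) * h) ω - B (k * h) ω|})
        (measurableSet_le (by fun_prop) (((hm _).sub (hm _)).abs))
        (integrable_cos_comp hm l m _) ?_).trans (measureReal_increment_le hB h hd0.le k)
      rintro ω ⟨hω, hω'⟩
      by_cases hω2 : ω ∈ {ω | d ≤ |B ((k + 1 : ℕ) * h) ω - B (k * h) ω|}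
      · rw [Set.indicator_of_mem hω2]
        exact Real.cos_le_one _
      · rw [Set.indicator_of_notMem hω2]
        have h3 : |B ((k + 1 : ℕ) * h) ω - m| ≤ d / 2 + d := by
          have := abs_sub_le (B ((k + 1 : ℕ) * h) ω) (B (k * h) ω) m
          have := hin _ (hω k le_rfl)
          have := not_le.1 fun h' : d ≤ |B ((k + 1 : ℕ) * h) ω - B (k * h) ω| ↦ hω2 h'
          linarith
        have h4 : l * (d / 2) ≤ |l * (B ((k + 1 : ℕ) * h) ω - m)| := by
          rw [abs_mul, abs_of_pos hl0]
          gcongr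
          exact hout _ hω'
        have h5 : |l * (B ((k + 1 : ℕ) * h) ω - m)| ≤ l * (d / 2 + d) := by
          rw [abs_mul, abs_of_pos hl0]
          gcongr
        rw [← Real.cos_abs]
        exact Real.cos_nonpos_of_pi_div_two_le_of_le (by linarith) (by linarith)
    simp only [hM]
    linarith
  have hMn := le_pow_mul_add_of_succ_le (Real.exp_nonneg _)
    (Real.exp_le_one_iff.2 (by rw [neg_nonpos]; positivity)) (by positivity) hstep n
  rw [exp_neg_mul_sq_pow] at hMn
  have hM0 : M 0 = -Real.cos (l * m) := by
    have h0 : ∀ᵐ ω ∂P, ω ∈ skeletonStays B h (Set.Icc u v) 0 := by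
      filter_upwards [hB.eval_zero_ae_eq_zero] with ω hω
      intro j hj
      obtain rfl : j = 0 := by omega
      simp only [Nat.cast_zero, zero_mul, hω]
      exact ⟨hu.le, hv.le⟩
    simp only [hM, Measure.restrict_eq_self_of_ae_mem h0]
    have : ∫ ω, Real.cos (l * (B ((0 : ℕ) * h) ω - m)) ∂P = ∫ ω, Real.cos (l * m) ∂P := by
      refine integral_congr_ae ?_
      filter_upwards [hB.eval_zero_ae_eq_zero] with ω hω
      simp [hω]
    rw [this]
    simp
  have hMup : -M n ≤ P.real (skeletonStays B h (Set.Icc u v) n) := by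
    simp only [hM, neg_neg]
    have hs := measurableSet_skeletonStays (D := Set.Icc u v) hm h measurableSet_Icc n
    refine setIntegral_le_measureReal_of_le_indicator hs hs
      (integrable_cos_comp hm l m _) fun ω hω ↦ ?_
    rw [Set.indicator_of_mem hω]
    exact Real.cos_le_one _
  rw [hM0] at hMn
  linarith

end SkeletonBounds

/-! ### Refining the dyadic grid to continuous time -/

section PathStays

/-- The set of paths that are in `D` at all the dyadic multiples of `T` in `[0, T]`. -/
def pathStays (T : ℝ≥0) (D : Set ℝ) : Set (ℝ≥0 → ℝ) :=
  {y | ∀ N k : ℕ, k ≤ 2 ^ N → y (k * (T / 2 ^ N)) ∈ D}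

theorem measurableSet_pathStays (T : ℝ≥0) {D : Set ℝ} (hD : MeasurableSet D) :
    MeasurableSet (pathStays T D) := by
  have : pathStays T D = ⋂ (N : ℕ) (k : ℕ) (_ : k ≤ 2 ^ N),
      (fun y : ℝ≥0 → ℝ ↦ y (k * (T / 2 ^ N))) ⁻¹' D := by
    ext; simp [pathStays]
  rw [this]
  exact .iInter fun N ↦ .iInter fun k ↦ .iInter fun _ ↦ measurable_pi_apply _ hD

theorem dyadic_mul_le (T : ℝ≥0) {N k : ℕ} (hk : k ≤ 2 ^ N) : (k : ℝ≥0) * (T / 2 ^ N) ≤ T := by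
  have h1 : (k : ℝ≥0) ≤ 2 ^ N := by exact_mod_cast hk
  calc (k : ℝ≥0) * (T / 2 ^ N) ≤ 2 ^ N * (T / 2 ^ N) := by gcongr
    _ = T := by field_simp

theorem mem_pathStays_of_forall_le {T : ℝ≥0} {D : Set ℝ} {y : ℝ≥0 → ℝ}
    (h : ∀ s ≤ T, y s ∈ D) : y ∈ pathStays T D :=
  fun _ _ hk ↦ h _ (dyadic_mul_le T hk)

/-- Dyadic times are dense, so a continuous path loses nothing. Using only countably many times
keeps `pathStays` measurable in the product space, as independence from the endpoints requires. -/
theorem mem_of_mem_pathStays {T : ℝ≥0} (hT : T ≠ 0) {D : Set ℝ} (hD : IsClosed D) {y : ℝ≥0 → ℝ}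
    (hy : Continuous y) (h : y ∈ pathStays T D) {s : ℝ≥0} (hs : s ≤ T) : y s ∈ D := by
  have hT' : (0 : ℝ) < T := by positivity
  have hx : Tendsto (fun N : ℕ ↦ (2 : ℝ) ^ N) atTop atTop :=
    tendsto_pow_atTop_atTop_of_one_lt one_lt_two
  have h1 : Tendsto (fun N : ℕ ↦ ((⌊(s / T : ℝ) * 2 ^ N⌋₊ : ℝ≥0) * (T / 2 ^ N) : ℝ≥0)) atTop
      (𝓝 s) := by
    rw [← NNReal.tendsto_coe]
    have := ((tendsto_nat_floor_mul_div_atTop (R := ℝ) (a := s / T) (by positivity)).comp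
      hx).mul_const (T : ℝ)
    rw [div_mul_cancel₀ _ hT'.ne'] at this
    refine this.congr fun N ↦ ?_
    simp only [Function.comp_apply]
    push_cast
    ring
  refine hD.mem_of_tendsto ((hy.tendsto s).comp h1) (.of_forall fun N ↦ h N _ ?_)
  refine Nat.floor_le_of_le ?_
  push_cast
  have : (s / T : ℝ) ≤ 1 := div_le_one_of_le₀ (by exact_mod_cast hs) hT'.le
  calc (s / T : ℝ) * 2 ^ N ≤ 1 * 2 ^ N := by gcongr
    _ = 2 ^ N := one_mul _

theorem tendsto_two_pow_mul_exp {T : ℝ≥0} (hT : T ≠ 0) {r : ℝ} (hr : 0 < r) :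
    Tendsto (fun N : ℕ ↦ ((2 ^ N : ℕ) : ℝ) *
      (2 * Real.exp (-r ^ 2 / (2 * (T / 2 ^ N : ℝ≥0))))) atTop (𝓝 0) := by
  have hT' : (0 : ℝ) < T := by positivity
  have hx : Tendsto (fun N : ℕ ↦ r ^ 2 / (2 * T) * (2 : ℝ) ^ N) atTop atTop :=
    (tendsto_pow_atTop_atTop_of_one_lt one_lt_two).const_mul_atTop (by positivity)
  have := ((Real.tendsto_pow_mul_exp_neg_atTop_nhds_zero 1).comp hx).const_mul (4 * T / r ^ 2)
  rw [mul_zero] at this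
  refine this.congr fun N ↦ ?_
  simp only [Function.comp_apply, pow_one]
  push_cast
  rw [show -(r ^ 2 / (2 * T) * (2 : ℝ) ^ N) = -r ^ 2 / (2 * (T / 2 ^ N)) by field_simp]
  field_simp
  ring

theorem setOf_mem_pathStays_eq_iInter {Ω : Type*} (B : ℝ≥0 → Ω → ℝ) (T : ℝ≥0) (D : Set ℝ) :
    {ω | (fun t ↦ B t ω) ∈ pathStays T D} = ⋂ N : ℕ, skeletonStays B (T / 2 ^ N) D (2 ^ N) := by
  ext; simp [pathStays, skeletonStays]

theorem antitone_skeletonStays_dyadic {Ω : Type*} (B : ℝ≥0 → Ω → ℝ) (T : ℝ≥0) (D : Set ℝ) :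
    Antitone fun N : ℕ ↦ skeletonStays B (T / 2 ^ N) D (2 ^ N) := by
  refine antitone_nat_of_succ_le fun N ω hω j hj ↦ ?_
  -- The `j`-th time of one dyadic level is the `2 j`-th time of the next.
  have := hω (2 * j) (by rw [pow_succ]; omega)
  convert this using 2
  push_cast
  field_simp
  ring

variable {Ω : Type*} [MeasurableSpace Ω] {P : Measure Ω} {B : ℝ≥0 → Ω → ℝ}

/-- A modification agrees almost surely at the countably many times that `pathStays` inspects. -/
theorem ProbabilityTheory.IsPreBrownianReal.exists_measurable (hB : IsPreBrownianReal B P) :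
    ∃ B' : ℝ≥0 → Ω → ℝ, IsPreBrownianReal B' P ∧ (∀ t, Measurable (B' t)) ∧
      ∀ (T : ℝ≥0) (D : Set ℝ), P.real {ω | (fun t ↦ B t ω) ∈ pathStays T D} =
        P.real {ω | (fun t ↦ B' t ω) ∈ pathStays T D} := by
  refine ⟨fun t ↦ (hB.aemeasurable t).mk, hB.congr fun t ↦ (hB.aemeasurable t).ae_eq_mk,
    fun t ↦ (hB.aemeasurable t).measurable_mk, fun T D ↦ measureReal_congr ?_⟩
  have : ∀ᵐ ω ∂P, ∀ N k : ℕ, B (k * (T / 2 ^ N)) ω =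
      (hB.aemeasurable (k * (T / 2 ^ N))).mk _ ω :=
    ae_all_iff.2 fun N ↦ ae_all_iff.2 fun k ↦ (hB.aemeasurable _).ae_eq_mk
  filter_upwards [this] with ω hω
  refine propext ?_
  refine forall_congr' fun N ↦ forall_congr' fun k ↦ imp_congr_right fun _ ↦ ?_
  simp only [hω N k]

theorem measureReal_pathStays_upper (hB : IsPreBrownianReal B P) {T : ℝ≥0} (hT : T ≠ 0)
    {u v θ : ℝ} (huv : u < v) (hθ : 0 < θ) (hθ1 : θ < 1) :
    P.real {ω | (fun t ↦ B t ω) ∈ pathStays T (Set.Icc u v)} * Real.cos (θ * (Real.pi / 2)) ≤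
      Real.exp (-(T * (θ * Real.pi / (v - u)) ^ 2 / 2)) := by
  have := hB.isGaussianProcess.isProbabilityMeasure
  obtain ⟨B', hB', hm, hPB⟩ := hB.exists_measurable
  rw [hPB, setOf_mem_pathStays_eq_iInter]
  have hr : 0 < (v - u) / (2 * θ) - (v - u) / 2 :=
    sub_pos.2 (div_lt_div_of_pos_left (by linarith) (by positivity) (by linarith))
  have hlim := (tendsto_two_pow_mul_exp hT hr).const_add
    (Real.exp (-(T * (θ * Real.pi / (v - u)) ^ 2 / 2)))
  rw [add_zero] at hlim
  refine ge_of_tendsto' hlim fun N ↦ ?_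
  have h1 := skeletonStays_upper_bound hB' hm (T / 2 ^ N) huv hθ hθ1 (2 ^ N)
  have h2 : (((2 ^ N : ℕ) : ℝ) * ((T / 2 ^ N : ℝ≥0) : ℝ)) = T := by push_cast; field_simp
  rw [h2] at h1
  refine le_trans ?_ h1
  have : 0 ≤ Real.cos (θ * (Real.pi / 2)) :=
    Real.cos_nonneg_of_mem_Icc ⟨by nlinarith [Real.pi_pos], by nlinarith [Real.pi_pos]⟩
  exact mul_le_mul_of_nonneg_right (measureReal_mono (Set.iInter_subset _ N)) this

theorem measureReal_pathStays_lower (hB : IsPreBrownianReal B P) {T : ℝ≥0} (hT : T ≠ 0)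
    {u v : ℝ} (hu : u < 0) (hv : 0 < v) :
    Real.exp (-(T * (Real.pi / (v - u)) ^ 2 / 2)) *
        Real.cos (Real.pi / (v - u) * ((u + v) / 2)) ≤
      P.real {ω | (fun t ↦ B t ω) ∈ pathStays T (Set.Icc u v)} := by
  have := hB.isGaussianProcess.isProbabilityMeasure
  obtain ⟨B', hB', hm, hPB⟩ := hB.exists_measurable
  rw [hPB, setOf_mem_pathStays_eq_iInter]
  have hlim := (tendsto_two_pow_mul_exp hT (r := v - u) (by linarith)).const_sub
    (Real.exp (-(T * (Real.pi / (v - u)) ^ 2 / 2)) *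
        Real.cos (Real.pi / (v - u) * ((u + v) / 2)))
  rw [sub_zero] at hlim
  have hlim2 := (ENNReal.tendsto_toReal (measure_ne_top P _)).comp <|
    tendsto_measure_iInter_atTop (μ := P)
      (fun N ↦ (measurableSet_skeletonStays hm (T / 2 ^ N) (D := Set.Icc u v) measurableSet_Icc
        (2 ^ N)).nullMeasurableSet)
      (antitone_skeletonStays_dyadic B' T _) ⟨0, measure_ne_top P _⟩
  refine le_of_tendsto_of_tendsto' hlim hlim2 fun N ↦ ?_
  have h1 := skeletonStays_lower_bound hB' hm (T / 2 ^ N) hu hv (2 ^ N)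
  have h2 : (((2 ^ N : ℕ) : ℝ) * ((T / 2 ^ N : ℝ≥0) : ℝ)) = T := by push_cast; field_simp
  rw [h2] at h1
  exact h1

end PathStays

/-! ### Calculus of exponential decay rates -/

section Decay

variable {φ p q : ℝ → ℝ} {κ κ' : ℝ}

/-- `p ≤ exp (-(κ - o(1)) φ)` at infinity. -/
def DecaysAtLeast (φ : ℝ → ℝ) (κ : ℝ) (p : ℝ → ℝ) : Prop :=
  ∀ ε > 0, ∀ᶠ t in atTop, p t ≤ Real.exp (-((κ - ε) * φ t))

/-- `p ≥ exp (-(κ + o(1)) φ)` at infinity. -/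
def DecaysAtMost (φ : ℝ → ℝ) (κ : ℝ) (p : ℝ → ℝ) : Prop :=
  ∀ ε > 0, ∀ᶠ t in atTop, Real.exp (-((κ + ε) * φ t)) ≤ p t

theorem DecaysAtLeast.mul (hp : DecaysAtLeast φ κ p) (hq : DecaysAtLeast φ κ' q)
    (hq0 : ∀ t, 0 ≤ q t) :
    DecaysAtLeast φ (κ + κ') fun t ↦ p t * q t := by
  intro ε hε
  filter_upwards [hp (ε / 2) (by positivity), hq (ε / 2) (by positivity)] with t h1 h2
  calc p t * q t ≤ _ := mul_le_mul h1 h2 (hq0 t) (Real.exp_nonneg _)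
    _ = _ := by rw [← Real.exp_add]; congr 1; ring

theorem DecaysAtMost.mul (hp : DecaysAtMost φ κ p) (hq : DecaysAtMost φ κ' q) :
    DecaysAtMost φ (κ + κ') fun t ↦ p t * q t := by
  intro ε hε
  filter_upwards [hp (ε / 2) (by positivity), hq (ε / 2) (by positivity)] with t h1 h2
  calc _ = _ := by
        rw [show -((κ + κ' + ε) * φ t) = -((κ + ε / 2) * φ t) + -((κ' + ε / 2) * φ t) by ring,
          Real.exp_add]
    _ ≤ p t * q t := mul_le_mul h1 h2 (Real.exp_nonneg _) ((Real.exp_nonneg _).trans h1)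

theorem DecaysAtLeast.mono (hp : DecaysAtLeast φ κ p) (hφ : Tendsto φ atTop atTop)
    (h : κ' ≤ κ) : DecaysAtLeast φ κ' p := by
  intro ε hε
  filter_upwards [hp ε hε, hφ.eventually_ge_atTop 0] with t h1 h2
  refine h1.trans (Real.exp_le_exp.2 (neg_le_neg ?_))
  gcongr

theorem DecaysAtLeast.const_mul (hp : DecaysAtLeast φ κ p) (hφ : Tendsto φ atTop atTop) {C : ℝ}
    (hC : 0 < C) : DecaysAtLeast φ κ fun t ↦ C * p t := by
  intro ε hε
  have h2 := (Real.tendsto_exp_atTop.comp (hφ.const_mul_atTop (half_pos hε))).eventually_ge_atTop C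
  filter_upwards [hp (ε / 2) (half_pos hε), h2] with t h1 h2
  calc C * p t ≤ Real.exp (ε / 2 * φ t) * Real.exp (-((κ - ε / 2) * φ t)) :=
        (mul_le_mul_of_nonneg_left h1 hC.le).trans (by gcongr; exact h2)
    _ = _ := by rw [← Real.exp_add]; congr 1; ring

theorem DecaysAtMost.const_mul (hp : DecaysAtMost φ κ p) (hφ : Tendsto φ atTop atTop) {C : ℝ}
    (hC : 0 < C) : DecaysAtMost φ κ fun t ↦ C * p t := by
  intro ε hε
  have h2 := (Real.tendsto_exp_atTop.comp
    (hφ.const_mul_atTop (half_pos hε))).eventually_ge_atTop C⁻¹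
  filter_upwards [hp (ε / 2) (half_pos hε), h2] with t h1 h2
  have h3 : Real.exp (-(ε / 2 * φ t)) ≤ C := by
    rw [Real.exp_neg]
    exact inv_le_of_inv_le₀ hC h2
  calc _ = Real.exp (-(ε / 2 * φ t)) * Real.exp (-((κ + ε / 2) * φ t)) := by
        rw [← Real.exp_add]; congr 1; ring
    _ ≤ C * p t := mul_le_mul h3 h1 (Real.exp_nonneg _) hC.le

/-- The number of terms is fixed while `φ` tends to infinity, so `exp (ε φ / 2)` absorbs it. -/
theorem DecaysAtLeast.finset_sum (hφ : Tendsto φ atTop atTop) {ι : Type*} (s : Finset ι)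
    {p : ι → ℝ → ℝ} (hp : ∀ i ∈ s, DecaysAtLeast φ κ (p i)) :
    DecaysAtLeast φ κ fun t ↦ ∑ i ∈ s, p i t := by
  have h1 : DecaysAtLeast φ κ fun t ↦ Real.exp (-(κ * φ t)) := by
    intro ε hε
    filter_upwards [hφ.eventually_ge_atTop 0] with t ht
    refine Real.exp_le_exp.2 (neg_le_neg ?_)
    gcongr
    linarith
  intro ε hε
  have h2 := (Real.tendsto_exp_atTop.comp
    (hφ.const_mul_atTop (half_pos hε))).eventually_ge_atTop (s.card : ℝ)
  filter_upwards [(Finset.eventually_all s).2 fun i hi ↦ hp i hi (ε / 2) (half_pos hε), h2]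
    with t h3 h4
  calc ∑ i ∈ s, p i t ≤ s.card * Real.exp (-((κ - ε / 2) * φ t)) := by
        simpa using Finset.sum_le_sum h3
    _ ≤ Real.exp (ε / 2 * φ t) * Real.exp (-((κ - ε / 2) * φ t)) := by gcongr; exact h4
    _ = _ := by rw [← Real.exp_add]; congr 1; ring

theorem DecaysAtLeast.add (hp : DecaysAtLeast φ κ p) (hq : DecaysAtLeast φ κ q)
    (hφ : Tendsto φ atTop atTop) : DecaysAtLeast φ κ fun t ↦ p t + q t := by
  have := DecaysAtLeast.finset_sum (κ := κ) hφ Finset.univ (p := fun b : Bool ↦ if b then p else q)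
    (by simp [hp, hq])
  simpa using this

theorem isEquivalent_neg_log_of_decays (hφ : Tendsto φ atTop atTop) (hκ : 0 < κ)
    (h1 : ∀ ε > 0, DecaysAtLeast φ (κ - ε) p) (h2 : ∀ ε > 0, DecaysAtMost φ (κ + ε) p) :
    Asymptotics.IsEquivalent atTop (fun t ↦ -Real.log (p t)) (fun t ↦ κ * φ t) := by
  refine Asymptotics.isLittleO_iff.2 fun δ hδ ↦ ?_
  have hε : 0 < δ * κ / 2 := by positivity
  filter_upwards [h1 _ hε _ hε, h2 _ hε _ hε, hφ.eventually_ge_atTop 0] with t h3 h4 h5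
  have h6 : 0 < p t := (Real.exp_pos _).trans_le h4
  have h7 := (Real.log_le_iff_le_exp h6).2 h3
  have h8 := (Real.le_log_iff_exp_le h6).2 h4
  rw [Pi.sub_apply, Real.norm_eq_abs, Real.norm_eq_abs, abs_of_nonneg (mul_nonneg hκ.le h5),
    abs_le]
  constructor <;> nlinarith

theorem decaysAtLeast_of_isEquivalent (hφ : Tendsto φ atTop atTop) (hκ : 0 < κ)
    (hp : ∀ t, 0 ≤ p t)
    (h : Asymptotics.IsEquivalent atTop (fun t ↦ -Real.log (p t)) (fun t ↦ κ * φ t)) :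
    DecaysAtLeast φ κ p := by
  intro ε hε
  filter_upwards [Asymptotics.isLittleO_iff.1 h (c := ε / κ) (by positivity),
    hφ.eventually_ge_atTop 0] with t h1 h2
  rcases (hp t).eq_or_lt with h0 | h0
  · rw [← h0]; exact Real.exp_nonneg _
  rw [Pi.sub_apply, Real.norm_eq_abs, Real.norm_eq_abs, abs_of_nonneg (mul_nonneg hκ.le h2),
    abs_le, ← mul_assoc, div_mul_cancel₀ _ hκ.ne'] at h1
  refine (Real.log_le_iff_le_exp h0).1 ?_
  linarith [h1.1]

theorem decaysAtMost_of_isEquivalent (hφ : Tendsto φ atTop atTop) (hκ : 0 < κ)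
    (hp : ∀ t, 0 ≤ p t)
    (h : Asymptotics.IsEquivalent atTop (fun t ↦ -Real.log (p t)) (fun t ↦ κ * φ t)) :
    DecaysAtMost φ κ p := by
  intro ε hε
  filter_upwards [Asymptotics.isLittleO_iff.1 h (c := ε / κ) (by positivity),
    -- A relative error below `1` excludes `p t = 0`, where `Real.log` takes the default value `0`.
    Asymptotics.isLittleO_iff.1 h (c := 1 / 2) (by positivity),
    hφ.eventually_gt_atTop 0] with t h1 h1' h2
  rw [Pi.sub_apply, Real.norm_eq_abs, Real.norm_eq_abs, abs_of_pos (mul_pos hκ h2), abs_le]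
    at h1 h1'
  rw [← mul_assoc, div_mul_cancel₀ _ hκ.ne'] at h1
  have h0 : 0 < p t := by
    refine (hp t).lt_of_ne fun h0 ↦ ?_
    rw [← h0, Real.log_zero] at h1'
    nlinarith [h1'.1]
  refine (Real.le_log_iff_exp_le h0).1 ?_
  linarith [h1.2]

end Decay

/-! ### The variational problem for the constant -/

section Constants

variable {β c : ℝ}

theorem rpow_add_le_of_le_one (hβ : 0 < β) (hβ' : β ≤ 1) {x y : ℝ} (hx : 0 ≤ x) (hy : 0 ≤ y) :
    (x + y) ^ β ≤ x ^ β + y ^ β := by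
  have := NNReal.rpow_add_le_add_rpow ⟨x, hx⟩ ⟨y, hy⟩ hβ.le hβ'
  exact_mod_cast this

/-- The minimum over `x > 0` of `c x ^ β + π ^ 2 / (2 x ^ 2)`. -/
noncomputable def exitRate (β c : ℝ) : ℝ :=
  (2 + β) / 2 * c ^ (2 / (2 + β)) * β ^ (-β / (2 + β)) * Real.pi ^ (2 * β / (2 + β))

/-- The minimizer over `x > 0` of `c x ^ β + π ^ 2 / (2 x ^ 2)`. -/
noncomputable def optimalScale (β c : ℝ) : ℝ := (Real.pi ^ 2 / (c * β)) ^ (1 / (2 + β))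

theorem exitRate_pos (hβ : 0 < β) (hc : 0 < c) : 0 < exitRate β c := by
  have := Real.pi_pos
  unfold exitRate
  positivity

theorem optimalScale_pos (hβ : 0 < β) (hc : 0 < c) : 0 < optimalScale β c := by
  have := Real.pi_pos
  unfold optimalScale
  positivity

theorem exitRate_eq (hβ : 0 < β) (hc : 0 < c) :
    exitRate β c = (2 + β) / 2 * (c * optimalScale β c ^ β) := by
  have hpi := Real.pi_pos
  have h2 : 2 + β ≠ 0 := by positivity
  unfold exitRate optimalScale
  rw [← Real.rpow_mul (by positivity), Real.div_rpow (by positivity) (by positivity),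
    Real.mul_rpow hc.le hβ.le, ← Real.rpow_natCast, ← Real.rpow_mul hpi.le,
    show ((2 : ℕ) : ℝ) * (1 / (2 + β) * β) = 2 * β / (2 + β) by push_cast; field_simp,
    show 1 / (2 + β) * β = β / (2 + β) by field_simp, neg_div, Real.rpow_neg hβ.le,
    show 2 / (2 + β) = 1 - β / (2 + β) by field_simp; ring, Real.rpow_sub hc, Real.rpow_one]
  field_simp

theorem pi_sq_div_optimalScale_sq (hβ : 0 < β) (hc : 0 < c) :
    Real.pi ^ 2 / (2 * optimalScale β c ^ 2) = β / 2 * (c * optimalScale β c ^ β) := by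
  have hpi := Real.pi_pos
  have hx := optimalScale_pos hβ hc
  have h : optimalScale β c ^ (2 + β) = Real.pi ^ 2 / (c * β) := by
    unfold optimalScale
    rw [← Real.rpow_mul (by positivity), one_div_mul_cancel (by positivity), Real.rpow_one]
  rw [Real.rpow_add hx, Real.rpow_two] at h
  field_simp at h ⊢
  linarith

/-- At the minimizer `x` the two terms are in ratio `2 : β`. With `y = z x` and these weights, the
powers of `z` cancel in the geometric mean, so AM-GM gives the bound. -/
theorem exitRate_le (hβ : 0 < β) (hc : 0 < c) {y : ℝ} (hy : 0 < y) :
    exitRate β c ≤ c * y ^ β + Real.pi ^ 2 / (2 * y ^ 2) := by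
  have hx := optimalScale_pos hβ hc
  set x := optimalScale β c with hxdef
  obtain ⟨z, hz⟩ : ∃ z, z = y / x := ⟨_, rfl⟩
  have hz0 : 0 < z := by rw [hz]; positivity
  have hyz : y = z * x := by rw [hz]; field_simp
  have h1 := Real.geom_mean_le_arith_mean2_weighted (w₁ := 2 / (2 + β)) (w₂ := β / (2 + β))
    (p₁ := z ^ β) (p₂ := z ^ (-2 : ℝ)) (by positivity) (by positivity) (by positivity)
    (by positivity) (by field_simp)
  rw [← Real.rpow_mul hz0.le, ← Real.rpow_mul hz0.le, ← Real.rpow_add hz0,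
    show β * (2 / (2 + β)) + -2 * (β / (2 + β)) = 0 by ring, Real.rpow_zero,
    Real.rpow_neg hz0.le, Real.rpow_two] at h1
  have h2 : (2 + β) / 2 ≤ z ^ β + β / 2 * (z ^ 2)⁻¹ := by
    have : z ^ β + β / 2 * (z ^ 2)⁻¹ =
        (2 + β) / 2 * (2 / (2 + β) * z ^ β + β / (2 + β) * (z ^ 2)⁻¹) := by field_simp
    rw [this]
    exact le_mul_of_one_le_right (by positivity) h1
  have h3 : Real.pi ^ 2 / (2 * y ^ 2) = β / 2 * (c * x ^ β) * (z ^ 2)⁻¹ := by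
    rw [← pi_sq_div_optimalScale_sq hβ hc, hyz, ← hxdef]; field_simp
  rw [exitRate_eq hβ hc, h3, hyz, Real.mul_rpow hz0.le hx.le, ← hxdef]
  have : 0 ≤ c * x ^ β := by positivity
  nlinarith

end Constants

/-! ### Tails and confinement at the scale `t ^ (1 / (2 + β))` -/

section Scaling

variable {β c : ℝ}

theorem tendsto_scale (hβ : 0 < β) : Tendsto (fun t : ℝ ↦ t ^ (1 / (2 + β))) atTop atTop :=
  tendsto_rpow_atTop (by positivity)

theorem tendsto_rate (hβ : 0 < β) : Tendsto (fun t : ℝ ↦ t ^ (β / (2 + β))) atTop atTop :=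
  tendsto_rpow_atTop (by positivity)

theorem scale_rpow {t : ℝ} (ht : 0 ≤ t) : (t ^ (1 / (2 + β))) ^ β = t ^ (β / (2 + β)) := by
  rw [← Real.rpow_mul ht, one_div_mul_eq_div]

theorem rate_mul_scale_sq (hβ : 0 < β) {t : ℝ} (ht : 0 < t) :
    t ^ (β / (2 + β)) * (t ^ (1 / (2 + β))) ^ 2 = t := by
  rw [← Real.rpow_natCast, ← Real.rpow_mul ht.le, ← Real.rpow_add ht,
    show β / (2 + β) + 1 / (2 + β) * ((2 : ℕ) : ℝ) = 1 by push_cast; field_simp; ring,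
    Real.rpow_one]

theorem isEquivalent_tail_comp_scale (hβ : 0 < β) {q : ℝ → ℝ}
    (hq : Asymptotics.IsEquivalent atTop (fun t ↦ -Real.log (q t)) (fun t ↦ c * t ^ β))
    {a : ℝ} (ha : 0 < a) :
    Asymptotics.IsEquivalent atTop (fun t ↦ -Real.log (q (a * t ^ (1 / (2 + β)))))
      (fun t ↦ c * a ^ β * t ^ (β / (2 + β))) := by
  refine (hq.comp_tendsto ((tendsto_scale hβ).const_mul_atTop ha)).congr_right ?_
  filter_upwards [eventually_ge_atTop 0] with t ht
  simp only [Function.comp_apply]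
  rw [Real.mul_rpow ha.le (by positivity), scale_rpow ht, mul_assoc]

theorem decaysAtMost_tail (hβ : 0 < β) (hc : 0 < c) {q : ℝ → ℝ} (hq0 : ∀ t, 0 ≤ q t)
    (hq : Asymptotics.IsEquivalent atTop (fun t ↦ -Real.log (q t)) (fun t ↦ c * t ^ β))
    {a : ℝ} (ha : 0 < a) :
    DecaysAtMost (fun t ↦ t ^ (β / (2 + β))) (c * a ^ β) fun t ↦ q (a * t ^ (1 / (2 + β))) :=
  decaysAtMost_of_isEquivalent (tendsto_rate hβ) (by positivity) (fun _ ↦ hq0 _)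
    (isEquivalent_tail_comp_scale hβ hq ha)

theorem decaysAtLeast_tail (hβ : 0 < β) (hc : 0 < c) {q : ℝ → ℝ} (hq0 : ∀ t, 0 ≤ q t)
    (hq1 : ∀ t, q t ≤ 1)
    (hq : Asymptotics.IsEquivalent atTop (fun t ↦ -Real.log (q t)) (fun t ↦ c * t ^ β))
    {a : ℝ} (ha : 0 ≤ a) :
    DecaysAtLeast (fun t ↦ t ^ (β / (2 + β))) (c * a ^ β) fun t ↦ q (a * t ^ (1 / (2 + β))) := by
  -- For `a = 0` the rate is zero and `q ≤ 1` suffices; this case covers the bins that touch the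
  -- origin.
  rcases ha.eq_or_lt with rfl | ha
  · intro ε hε
    filter_upwards [eventually_ge_atTop 0] with t ht
    refine (hq1 _).trans (Real.one_le_exp ?_)
    rw [Real.zero_rpow hβ.ne', mul_zero, zero_sub, neg_mul, neg_neg]
    positivity
  · exact decaysAtLeast_of_isEquivalent (tendsto_rate hβ) (by positivity) (fun _ ↦ hq0 _)
      (isEquivalent_tail_comp_scale hβ hq ha)

variable {Ω : Type*} [MeasurableSpace Ω] {P : Measure Ω} {B : ℝ≥0 → Ω → ℝ}

theorem time_mul_sq_div (hβ : 0 < β) {t : ℝ} (ht : 0 < t) {a b x : ℝ} (hab : 0 < a + b) :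
    (t.toNNReal : ℝ) * (x / (b * t ^ (1 / (2 + β)) - -(a * t ^ (1 / (2 + β))))) ^ 2 / 2 =
      x ^ 2 / (2 * (a + b) ^ 2) * t ^ (β / (2 + β)) := by
  have h1 := rate_mul_scale_sq hβ ht
  have hL : 0 < t ^ (1 / (2 + β)) := by positivity
  rw [Real.coe_toNNReal _ ht.le]
  set L := t ^ (1 / (2 + β))
  have h2 : b * L - -(a * L) = (a + b) * L := by ring
  rw [h2]
  nth_rewrite 1 [← h1]
  field_simp

theorem decaysAtLeast_pathStays (hB : IsPreBrownianReal B P) (hβ : 0 < β) {a b : ℝ}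
    (hab : 0 < a + b) :
    DecaysAtLeast (fun t ↦ t ^ (β / (2 + β))) (Real.pi ^ 2 / (2 * (a + b) ^ 2)) fun t ↦
      P.real {ω | (fun s ↦ B s ω) ∈ pathStays t.toNNReal
        (Set.Icc (-(a * t ^ (1 / (2 + β)))) (b * t ^ (1 / (2 + β))))} := by
  have hpi := Real.pi_pos
  intro ε hε
  have hlim : Tendsto (fun θ : ℝ ↦ (θ * Real.pi) ^ 2 / (2 * (a + b) ^ 2)) (𝓝[<] 1)
      (𝓝 (Real.pi ^ 2 / (2 * (a + b) ^ 2))) := by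
    have : Continuous fun θ : ℝ ↦ (θ * Real.pi) ^ 2 / (2 * (a + b) ^ 2) := by fun_prop
    simpa using (this.tendsto 1).mono_left nhdsWithin_le_nhds
  -- Taking `θ` close to `1` costs `ε / 2` in the rate; the other half absorbs the constant `1 / cos
  -- (θ π / 2)`.
  obtain ⟨θ, h1, h2, h3⟩ := ((hlim.eventually_const_lt (sub_lt_self _ (half_pos hε))).and
    ((eventually_mem_nhdsWithin).and
      (mem_nhdsWithin_of_mem_nhds (lt_mem_nhds (zero_lt_one' ℝ))))).exists
  have h2 : θ < 1 := h2
  have h3 : 0 < θ := h3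
  have hcos : 0 < Real.cos (θ * (Real.pi / 2)) :=
    Real.cos_pos_of_mem_Ioo ⟨by nlinarith, by nlinarith⟩
  have hexp : DecaysAtLeast (fun t ↦ t ^ (β / (2 + β))) (Real.pi ^ 2 / (2 * (a + b) ^ 2) - ε / 2)
      fun t ↦ Real.exp (-((θ * Real.pi) ^ 2 / (2 * (a + b) ^ 2) * t ^ (β / (2 + β)))) := by
    intro ε' hε'
    filter_upwards [eventually_ge_atTop 0] with t ht
    refine Real.exp_le_exp.2 (neg_le_neg ?_)
    gcongr
    linarith
  filter_upwards [hexp.const_mul (tendsto_rate hβ) (inv_pos.2 hcos) _ (half_pos hε),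
    eventually_gt_atTop 0] with t h4 ht
  have hL : 0 < t ^ (1 / (2 + β)) := by positivity
  have h5 := measureReal_pathStays_upper hB (T := t.toNNReal) (by simpa using ht)
    (u := -(a * t ^ (1 / (2 + β)))) (v := b * t ^ (1 / (2 + β))) (by nlinarith) h3 h2
  rw [time_mul_sq_div hβ ht hab, ← le_div_iff₀ hcos] at h5
  rw [sub_sub, add_halves] at h4
  exact h5.trans ((div_eq_inv_mul _ _).le.trans h4)

/-- The starting point is at a fixed relative position inside the scaled interval, so the cosine
prefactor is a positive constant independent of `t`. -/
theorem decaysAtMost_pathStays (hB : IsPreBrownianReal B P) (hβ : 0 < β) {a b : ℝ}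
    (ha : 0 < a) (hb : 0 < b) :
    DecaysAtMost (fun t ↦ t ^ (β / (2 + β))) (Real.pi ^ 2 / (2 * (a + b) ^ 2)) fun t ↦
      P.real {ω | (fun s ↦ B s ω) ∈ pathStays t.toNNReal
        (Set.Icc (-(a * t ^ (1 / (2 + β)))) (b * t ^ (1 / (2 + β))))} := by
  have hpi := Real.pi_pos
  have hC : 0 < Real.cos (Real.pi / (a + b) * ((b - a) / 2)) := by
    have h : Real.pi / (a + b) * ((a + b) / 2) = Real.pi / 2 := by field_simp
    have h0 : 0 < Real.pi / (a + b) := by positivity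
    refine Real.cos_pos_of_mem_Ioo ⟨?_, ?_⟩ <;> nlinarith
  have hexp : DecaysAtMost (fun t ↦ t ^ (β / (2 + β))) (Real.pi ^ 2 / (2 * (a + b) ^ 2))
      fun t ↦ Real.exp (-(Real.pi ^ 2 / (2 * (a + b) ^ 2) * t ^ (β / (2 + β)))) := by
    intro ε' hε'
    filter_upwards [eventually_ge_atTop 0] with t ht
    refine Real.exp_le_exp.2 (neg_le_neg ?_)
    gcongr
    linarith
  intro ε hε
  filter_upwards [hexp.const_mul (tendsto_rate hβ) hC _ hε, eventually_gt_atTop 0] with t h4 ht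
  have hL : 0 < t ^ (1 / (2 + β)) := by positivity
  have h5 := measureReal_pathStays_lower hB (T := t.toNNReal) (by simpa using ht)
    (u := -(a * t ^ (1 / (2 + β)))) (v := b * t ^ (1 / (2 + β)))
    (neg_neg_of_pos (by positivity)) (by positivity)
  rw [time_mul_sq_div hβ ht (by positivity), mul_comm] at h5
  refine h4.trans (le_trans (le_of_eq ?_) h5)
  congr 2
  rw [show b * t ^ (1 / (2 + β)) - -(a * t ^ (1 / (2 + β))) = (a + b) * t ^ (1 / (2 + β)) by ring]
  field_simp
  ring

end Scaling

/-! ### Comparing the exit event with confinement to fixed intervals -/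

section ExitTime

theorem mem_of_lt_firstExitTime {y : ℝ≥0 → ℝ} {D : Set ℝ} {t : ℝ}
    (h : ENNReal.ofReal t < firstExitTime y D) {s : ℝ≥0} (hs : s ≤ t.toNNReal) : y s ∈ D := by
  by_contra hy
  have h1 : firstExitTime y D ≤ s := iInf₂_le s hy
  have h2 : (s : ℝ≥0∞) ≤ ENNReal.ofReal t := ENNReal.coe_le_coe.2 hs
  exact absurd h (not_lt.2 (h1.trans h2))

theorem lt_firstExitTime {y : ℝ≥0 → ℝ} (hy : Continuous y) {D : Set ℝ} (hD : IsOpen D) {t : ℝ}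
    (h : ∀ s ≤ t.toNNReal, y s ∈ D) : ENNReal.ofReal t < firstExitTime y D := by
  have h1 : y ⁻¹' D ∈ 𝓝 t.toNNReal := (hD.preimage hy).mem_nhds (h _ le_rfl)
  -- Openness keeps the path in `D` a little beyond `t`, which makes the inequality strict.
  obtain ⟨r, hr, hr'⟩ := exists_Ico_subset_of_mem_nhds h1 (exists_gt _)
  refine lt_of_lt_of_le (b := (r : ℝ≥0∞)) (ENNReal.coe_lt_coe.2 hr) (le_iInf₂ fun s hs ↦ ?_)
  by_contra! hlt
  rcases le_total s t.toNNReal with hle | hle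
  · exact hs (h s hle)
  · exact hs (hr' ⟨hle, by exact_mod_cast hlt⟩)

theorem exists_bin {d x : ℝ} (hx : 0 < x) (K : ℕ) (hK : x ≤ K * d) :
    ∃ i < K, i * d < x ∧ x ≤ (i + 1) * d := by
  induction K with
  | zero => simp at hK; linarith
  | succ K ih =>
    rcases le_or_gt x (K * d) with h | h
    · obtain ⟨i, hi, h'⟩ := ih h
      exact ⟨i, hi.trans (Nat.lt_succ_self K), h'⟩
    · exact ⟨K, Nat.lt_succ_self K, h, by simpa using hK⟩

variable {Ω' : Type*} [MeasurableSpace Ω'] {Q : Measure Ω'}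
  {Ω : Type*} [MeasurableSpace Ω] {P : Measure Ω}
  {ξ : Ω' → ℝ} {ξ₁ ξ₂ : Ω → ℝ} {Y : ℝ≥0 → Ω → ℝ}

theorem measureReal_lt_inter_lt_inter_pathStays
    (hξ₁ : IdentDistrib ξ₁ ξ P Q) (hξ₂ : IdentDistrib ξ₂ ξ P Q) (hξ₁ξ₂ : IndepFun ξ₁ ξ₂ P)
    (hξY : IndepFun (fun ω ↦ (ξ₁ ω, ξ₂ ω)) (fun ω (s : ℝ≥0) ↦ Y s ω) P)
    (x y : ℝ) (T : ℝ≥0) {D : Set ℝ} (hD : MeasurableSet D) :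
    P.real {ω | (x < ξ₁ ω ∧ y < ξ₂ ω) ∧ (fun s ↦ Y s ω) ∈ pathStays T D} =
      Q.real {ω | x < ξ ω} * Q.real {ω | y < ξ ω} *
        P.real {ω | (fun s ↦ Y s ω) ∈ pathStays T D} := by
  have h1 := hξY.measure_inter_preimage_eq_mul (Set.Ioi x ×ˢ Set.Ioi y) (pathStays T D)
    (measurableSet_Ioi.prod measurableSet_Ioi) (measurableSet_pathStays T hD)
  have h2 := hξ₁ξ₂.measure_inter_preimage_eq_mul (Set.Ioi x) (Set.Ioi y)
    measurableSet_Ioi measurableSet_Ioi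
  rw [hξ₁.measure_mem_eq measurableSet_Ioi, hξ₂.measure_mem_eq measurableSet_Ioi] at h2
  have h3 : (fun ω ↦ (ξ₁ ω, ξ₂ ω)) ⁻¹' (Set.Ioi x ×ˢ Set.Ioi y) =
      ξ₁ ⁻¹' Set.Ioi x ∩ ξ₂ ⁻¹' Set.Ioi y := rfl
  rw [h3, h2] at h1
  have h4 := congrArg ENNReal.toReal h1
  rw [ENNReal.toReal_mul, ENNReal.toReal_mul] at h4
  exact h4

/-- Either an endpoint exceeds `K d`, or both fall in bins `(i d, (i + 1) d]` and `(j d, (j + 1)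
d]`. In the latter case the lower bin edges bound the tails and the upper edges bound the interval.
-/
theorem exitTime_measureReal_le [IsProbabilityMeasure P]
    (hξ_pos : ∀ᵐ ω ∂Q, 0 < ξ ω)
    (hξ₁ : IdentDistrib ξ₁ ξ P Q) (hξ₂ : IdentDistrib ξ₂ ξ P Q) (hξ₁ξ₂ : IndepFun ξ₁ ξ₂ P)
    (hξY : IndepFun (fun ω ↦ (ξ₁ ω, ξ₂ ω)) (fun ω (s : ℝ≥0) ↦ Y s ω) P)
    (K : ℕ) (d t : ℝ) :
    P.real {ω | ENNReal.ofReal t < firstExitTime (fun s ↦ Y s ω) (Set.Ioo (-ξ₁ ω) (ξ₂ ω))} ≤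
      2 * Q.real {ω | K * d < ξ ω} + ∑ ij ∈ Finset.range K ×ˢ Finset.range K,
        Q.real {ω | ij.1 * d < ξ ω} * Q.real {ω | ij.2 * d < ξ ω} *
          P.real {ω | (fun s ↦ Y s ω) ∈ pathStays t.toNNReal
            (Set.Icc (-((ij.1 + 1) * d)) ((ij.2 + 1) * d))} := by
  have hp1 : ∀ᵐ ω ∂P, 0 < ξ₁ ω := hξ₁.symm.ae_snd measurableSet_Ioi hξ_pos
  have hp2 : ∀ᵐ ω ∂P, 0 < ξ₂ ω := hξ₂.symm.ae_snd measurableSet_Ioi hξ_pos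
  set E : ℕ × ℕ → Set Ω := fun ij ↦ {ω | (ij.1 * d < ξ₁ ω ∧ ij.2 * d < ξ₂ ω) ∧
    (fun s ↦ Y s ω) ∈ pathStays t.toNNReal (Set.Icc (-((ij.1 + 1) * d)) ((ij.2 + 1) * d))} with hE
  have hsub : P.real {ω | ENNReal.ofReal t <
      firstExitTime (fun s ↦ Y s ω) (Set.Ioo (-ξ₁ ω) (ξ₂ ω))} ≤
      P.real ((ξ₁ ⁻¹' Set.Ioi (K * d) ∪ ξ₂ ⁻¹' Set.Ioi (K * d)) ∪
        ⋃ ij ∈ Finset.range K ×ˢ Finset.range K, E ij) := by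
    refine ENNReal.toReal_mono (measure_ne_top _ _) (measure_mono_ae ?_)
    filter_upwards [hp1, hp2] with ω h1 h2 hω
    by_cases hK1 : K * d < ξ₁ ω
    · exact Or.inl (Or.inl hK1)
    by_cases hK2 : K * d < ξ₂ ω
    · exact Or.inl (Or.inr hK2)
    obtain ⟨i, hi, hi1, hi2⟩ := exists_bin h1 K (not_lt.1 hK1)
    obtain ⟨j, hj, hj1, hj2⟩ := exists_bin h2 K (not_lt.1 hK2)
    refine Or.inr (Set.mem_biUnion (x := (i, j)) (by simp [hi, hj]) ⟨⟨hi1, hj1⟩, ?_⟩)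
    refine mem_pathStays_of_forall_le fun s hs ↦ ?_
    have := mem_of_lt_firstExitTime hω hs
    exact ⟨(neg_le_neg hi2).trans this.1.le, this.2.le.trans hj2⟩
  have hK1 : P.real (ξ₁ ⁻¹' Set.Ioi (K * d)) = Q.real {ω | K * d < ξ ω} :=
    congrArg ENNReal.toReal (hξ₁.measure_mem_eq measurableSet_Ioi)
  have hK2 : P.real (ξ₂ ⁻¹' Set.Ioi (K * d)) = Q.real {ω | K * d < ξ ω} :=
    congrArg ENNReal.toReal (hξ₂.measure_mem_eq measurableSet_Ioi)
  refine hsub.trans ((measureReal_union_le _ _).trans (add_le_add ?_ ?_))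
  · refine (measureReal_union_le _ _).trans (le_of_eq ?_)
    rw [hK1, hK2, two_mul]
  · refine (measureReal_biUnion_finset_le _ _).trans (Finset.sum_le_sum fun ij _ ↦ le_of_eq ?_)
    exact measureReal_lt_inter_lt_inter_pathStays hξ₁ hξ₂ hξ₁ξ₂ hξY _ _ _ measurableSet_Icc

theorem le_exitTime_measureReal [IsProbabilityMeasure P]
    (hξ₁ : IdentDistrib ξ₁ ξ P Q) (hξ₂ : IdentDistrib ξ₂ ξ P Q) (hξ₁ξ₂ : IndepFun ξ₁ ξ₂ P)
    (hY : IsBrownianReal Y P)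
    (hξY : IndepFun (fun ω ↦ (ξ₁ ω, ξ₂ ω)) (fun ω (s : ℝ≥0) ↦ Y s ω) P)
    (x y : ℝ) {t : ℝ} (ht : 0 < t) :
    Q.real {ω | x < ξ ω} * Q.real {ω | y < ξ ω} *
        P.real {ω | (fun s ↦ Y s ω) ∈ pathStays t.toNNReal (Set.Icc (-x) y)} ≤
      P.real {ω | ENNReal.ofReal t <
        firstExitTime (fun s ↦ Y s ω) (Set.Ioo (-ξ₁ ω) (ξ₂ ω))} := by
  rw [← measureReal_lt_inter_lt_inter_pathStays hξ₁ hξ₂ hξ₁ξ₂ hξY _ _ _ measurableSet_Icc]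
  refine ENNReal.toReal_mono (measure_ne_top _ _) (measure_mono_ae ?_)
  filter_upwards [hY.cont] with ω hc hω
  obtain ⟨⟨h1, h2⟩, h3⟩ := hω
  refine lt_firstExitTime hc isOpen_Ioo fun s hs ↦ ?_
  have := mem_of_mem_pathStays (by simpa using ht) isClosed_Icc hc h3 hs
  exact ⟨(neg_lt_neg h1).trans_le this.1, this.2.trans_lt h2⟩

end ExitTime

/-! ### Matching decay rates for the exit time -/

section ExitTimeAsymptotics

variable {Ω' : Type*} [MeasurableSpace Ω'] {Q : Measure Ω'}
  {Ω : Type*} [MeasurableSpace Ω] {P : Measure Ω} [IsProbabilityMeasure P]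
  {β c : ℝ} {ξ : Ω' → ℝ} {ξ₁ ξ₂ : Ω → ℝ} {Y : ℝ≥0 → Ω → ℝ}

theorem decaysAtMost_exitTime (hβ : 0 < β) (hc : 0 < c)
    (hξ : Asymptotics.IsEquivalent atTop
      (fun t : ℝ ↦ -Real.log (Q.real {ω | t < ξ ω})) (fun t : ℝ ↦ c * t ^ β))
    (hξ₁ : IdentDistrib ξ₁ ξ P Q) (hξ₂ : IdentDistrib ξ₂ ξ P Q) (hY : IsBrownianReal Y P)
    (hξ₁ξ₂ : IndepFun ξ₁ ξ₂ P)
    (hξY : IndepFun (fun ω ↦ (ξ₁ ω, ξ₂ ω)) (fun ω (s : ℝ≥0) ↦ Y s ω) P) {ε : ℝ} (hε : 0 < ε) :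
    DecaysAtMost (fun t ↦ t ^ (β / (2 + β))) (exitRate β c + ε) fun t ↦ P.real
      {ω | ENNReal.ofReal t < firstExitTime (fun s ↦ Y s ω) (Set.Ioo (-ξ₁ ω) (ξ₂ ω))} := by
  have hx := optimalScale_pos hβ hc
  set x := optimalScale β c with hxdef
  -- The short side must be positive so that the path starts strictly inside; its tail costs less
  -- than `ε`.
  obtain ⟨a, ha, haε⟩ : ∃ a : ℝ, 0 < a ∧ c * a ^ β < ε := by
    have h1 : Tendsto (fun a : ℝ ↦ c * a ^ β) (𝓝[>] 0) (𝓝 0) := by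
      have : Tendsto (fun a : ℝ ↦ c * a ^ β) (𝓝 0) (𝓝 (c * 0 ^ β)) :=
        ((Real.continuousAt_rpow_const 0 β (Or.inr hβ.le)).tendsto).const_mul c
      rw [Real.zero_rpow hβ.ne', mul_zero] at this
      exact this.mono_left nhdsWithin_le_nhds
    obtain ⟨a, h2, h3⟩ := ((h1.eventually_lt_const hε).and eventually_mem_nhdsWithin).exists
    exact ⟨a, h3, h2⟩
  have hrate : c * a ^ β + c * x ^ β + Real.pi ^ 2 / (2 * (a + x) ^ 2) ≤ exitRate β c + ε := by
    have h1 : Real.pi ^ 2 / (2 * (a + x) ^ 2) ≤ Real.pi ^ 2 / (2 * x ^ 2) := by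
      gcongr
      linarith
    rw [hxdef, pi_sq_div_optimalScale_sq hβ hc, ← hxdef] at h1
    rw [exitRate_eq hβ hc, ← hxdef]
    linarith
  have hdecay := ((decaysAtMost_tail hβ hc (fun _ ↦ measureReal_nonneg) hξ ha).mul
    (decaysAtMost_tail hβ hc (fun _ ↦ measureReal_nonneg) hξ hx)).mul
    (decaysAtMost_pathStays hY.toIsPreBrownianReal hβ ha hx)
  intro ε' hε'
  filter_upwards [hdecay ε' hε', eventually_gt_atTop 0] with t h1 ht
  refine le_trans (Real.exp_le_exp.2 (neg_le_neg ?_)) (h1.trans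
    (le_exitTime_measureReal hξ₁ hξ₂ hξ₁ξ₂ hY hξY _ _ ht))
  gcongr

theorem decaysAtLeast_exitTime [IsProbabilityMeasure Q] (hβ : 0 < β) (hβ' : β ≤ 1) (hc : 0 < c)
    (hξ_pos : ∀ᵐ ω ∂Q, 0 < ξ ω)
    (hξ : Asymptotics.IsEquivalent atTop
      (fun t : ℝ ↦ -Real.log (Q.real {ω | t < ξ ω})) (fun t : ℝ ↦ c * t ^ β))
    (hξ₁ : IdentDistrib ξ₁ ξ P Q) (hξ₂ : IdentDistrib ξ₂ ξ P Q) (hY : IsPreBrownianReal Y P)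
    (hξ₁ξ₂ : IndepFun ξ₁ ξ₂ P)
    (hξY : IndepFun (fun ω ↦ (ξ₁ ω, ξ₂ ω)) (fun ω (s : ℝ≥0) ↦ Y s ω) P) {ε : ℝ} (hε : 0 < ε) :
    DecaysAtLeast (fun t ↦ t ^ (β / (2 + β))) (exitRate β c - ε) fun t ↦ P.real
      {ω | ENNReal.ofReal t < firstExitTime (fun s ↦ Y s ω) (Set.Ioo (-ξ₁ ω) (ξ₂ ω))} := by
  have hφ := tendsto_rate hβ
  -- The upper edges of two bins exceed the lower ones by `2 δ` in total, which by subadditivity of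
  -- `x ^ β` costs at most `ε` in the rate.
  obtain ⟨δ, hδ, hδε⟩ : ∃ δ : ℝ, 0 < δ ∧ c * (2 * δ) ^ β = ε := by
    refine ⟨(ε / c) ^ β⁻¹ / 2, by positivity, ?_⟩
    rw [mul_div_cancel₀ _ two_ne_zero, Real.rpow_inv_rpow (by positivity) hβ.ne']
    field_simp
  -- Beyond `K` bins a single tail already decays at the target rate. As `K` does not depend on `t`,
  -- the number of bin pairs stays fixed.
  obtain ⟨K, hK⟩ : ∃ K : ℕ, exitRate β c - ε ≤ c * (K * δ) ^ β := by
    have : Tendsto (fun K : ℕ ↦ c * (K * δ) ^ β) atTop atTop :=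
      ((tendsto_rpow_atTop hβ).comp
        (tendsto_natCast_atTop_atTop.atTop_mul_const hδ)).const_mul_atTop hc
    exact (this.eventually_ge_atTop _).exists
  have htail : ∀ a : ℝ, 0 ≤ a → DecaysAtLeast (fun t ↦ t ^ (β / (2 + β))) (c * a ^ β)
      fun t ↦ Q.real {ω | a * t ^ (1 / (2 + β)) < ξ ω} := fun a ha ↦
    decaysAtLeast_tail hβ hc (q := fun t ↦ Q.real {ω | t < ξ ω}) (fun _ ↦ measureReal_nonneg)
      (fun _ ↦ measureReal_le_one) hξ ha
  have hbin : ∀ ij ∈ Finset.range K ×ˢ Finset.range K,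
      DecaysAtLeast (fun t ↦ t ^ (β / (2 + β))) (exitRate β c - ε) fun t ↦
        Q.real {ω | ij.1 * δ * t ^ (1 / (2 + β)) < ξ ω} *
          Q.real {ω | ij.2 * δ * t ^ (1 / (2 + β)) < ξ ω} *
          P.real {ω | (fun s ↦ Y s ω) ∈ pathStays t.toNNReal
            (Set.Icc (-((ij.1 + 1) * δ * t ^ (1 / (2 + β))))
              ((ij.2 + 1) * δ * t ^ (1 / (2 + β))))} := by
    rintro ⟨i, j⟩ -
    refine (((htail _ (by positivity)).mul (htail _ (by positivity))
      fun _ ↦ measureReal_nonneg).mul (decaysAtLeast_pathStays hY hβ (by positivity))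
      fun _ ↦ measureReal_nonneg).mono hφ ?_
    have h1 := exitRate_le hβ hc (y := ((i + 1) * δ + (j + 1) * δ)) (by positivity)
    have h2 := rpow_add_le_of_le_one hβ hβ' (x := i * δ) (y := j * δ) (by positivity)
      (by positivity)
    have h3 := rpow_add_le_of_le_one hβ hβ' (x := i * δ + j * δ) (y := 2 * δ) (by positivity)
      (by positivity)
    rw [show (i * δ + j * δ + 2 * δ : ℝ) = (i + 1) * δ + (j + 1) * δ by ring] at h3
    have h4 : c * ((i + 1) * δ + (j + 1) * δ) ^ β ≤
        c * ((i * δ) ^ β + (j * δ) ^ β + (2 * δ) ^ β) := by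
      gcongr
      linarith
    linarith
  have hsum := (((htail (K * δ) (by positivity)).mono hφ hK).const_mul hφ two_pos).add
    (DecaysAtLeast.finset_sum hφ _ hbin) hφ
  intro ε' hε'
  filter_upwards [hsum ε' hε'] with t h1
  refine le_trans ?_ h1
  have := exitTime_measureReal_le hξ_pos hξ₁ hξ₂ hξ₁ξ₂ hξY K (δ * t ^ (1 / (2 + β))) t
  simpa only [mul_assoc] using this

end ExitTimeAsymptotics

theorem theorem3p1
    {Ω' : Type*} [MeasurableSpace Ω'] (Q : Measure Ω') [IsProbabilityMeasure Q]
    {Ω : Type*} [MeasurableSpace Ω] (P : Measure Ω) [IsProbabilityMeasure P]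
    (β c : ℝ) (hβ : 0 < β) (hβ' : β ≤ 1) (hc : 0 < c)
    (ξ : Ω' → ℝ) (hξ_pos : ∀ᵐ ω ∂Q, 0 < ξ ω)
    (hξ : Asymptotics.IsEquivalent atTop
      (fun t : ℝ ↦ -Real.log (Q.real {ω | t < ξ ω})) (fun t : ℝ ↦ c * t ^ β))
    (ξ₁ ξ₂ : Ω → ℝ) (Y : ℝ≥0 → Ω → ℝ)
    (hξ₁ : IdentDistrib ξ₁ ξ P Q) (hξ₂ : IdentDistrib ξ₂ ξ P Q)
    (hY : IsBrownianReal Y P)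
    (hξ₁ξ₂ : IndepFun ξ₁ ξ₂ P)
    (hξY : IndepFun (fun ω ↦ (ξ₁ ω, ξ₂ ω)) (fun ω (s : ℝ≥0) ↦ Y s ω) P) :
    Asymptotics.IsEquivalent atTop
      (fun t : ℝ ↦ -Real.log (P.real
        {ω | ENNReal.ofReal t < firstExitTime (fun s ↦ Y s ω) (Set.Ioo (-ξ₁ ω) (ξ₂ ω))}))
      (fun t : ℝ ↦ (2 + β) / 2 * c ^ (2 / (2 + β)) * β ^ (-β / (2 + β)) *
        Real.pi ^ (2 * β / (2 + β)) * t ^ (β / (2 + β))) :=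
  isEquivalent_neg_log_of_decays (tendsto_rate hβ) (exitRate_pos hβ hc)
    (fun _ hε ↦ decaysAtLeast_exitTime hβ hβ' hc hξ_pos hξ hξ₁ hξ₂ hY.toIsPreBrownianReal
      hξ₁ξ₂ hξY hε)
    (fun _ hε ↦ decaysAtMost_exitTime hβ hc hξ hξ₁ hξ₂ hY hξ₁ξ₂ hξY hε)
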